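/- A variety of groups is a class of groups closed under subgroups, quotients and arbitrary direct products, viewed as a full subcategory of the category of groups; it is called nontrivial if it is neither the class of all groups nor the class of trivial groups. For varieties $\mathcal N$ and $\mathcal Q$, let $\mathcal{NQ}$ be the variety of all groups $K$ having a normal subgroup $M$ with $M\in\mathcal N$ and $K/M\in\mathcal Q$. For a subgroup $H$ of a group $S\in\mathcal N$, let $\mathrm{dom}^{\mathcal N}_S(H)$ be the set of all $s\in S$ such that $f(s)=g(s)$ whenever $C\in\mathcal N$ and $f,g\colon S\to C$ are homomorphisms with $f|_H=g|_H$. Let $A\wr G$ denote the regular wreath product, i.e. the semidirect product of $A^G$ (all functions $G\to A$) by $G$, where $G$ permutes the coordinates regularly; for $H\le S$, the group $H\wr G$ is embedded in $S\wr G$ by viewing functions $G\to H$ as functions $G\to S$. Theorem 5.5. Let $\mathcal N$ be a nontrivial variety of groups, let $S\in\mathcal N$ be a finite nonabelian simple group, and let $H$ be a proper subgroup of $S$ such that $\mathrm{dom}^{\mathcal N}_S(H)=S$ (equivalently, $H\hookrightarrow S$ is a nonsurjective epimorphism in $\mathcal N$). Let $\mathcal Q$ be any nontrivial variety of groups. Then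 there is a finite (possibly trivial) group $G\in\mathcal Q$ such that the groups $H\wr G$ and $S\wr G$ are finite and belong to $\mathcal{NQ}$, and the embedding $H\wr G\hookrightarrow S\wr G$ is a nonsurjective epimorphism in $\mathcal{NQ}$. -/

import Mathlib

open CategoryTheory

universe u

/-- A variety of groups: a class of groups (the objects of a full subcategory of the category of
groups) closed under subgroups, quotients and arbitrary direct products.
Closure under subgroups (quotients) is stated for injective (surjective) homomorphisms, so that
closure under isomorphism is included; the empty product gives the trivial group. -/
structure GroupVariety where
  /-- The class of groups belonging to the variety. -/
  Obj : ObjectProperty GrpCat.{u}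
  of_injective : ∀ {A B : Type u} [Group A] [Group B] (f : A →* B),
    Function.Injective f → Obj (GrpCat.of B) → Obj (GrpCat.of A)
  of_surjective : ∀ {A B : Type u} [Group A] [Group B] (f : A →* B),
    Function.Surjective f → Obj (GrpCat.of A) → Obj (GrpCat.of B)
  pi : ∀ {ι : Type u} (A : ι → Type u) [∀ i, Group (A i)],
    (∀ i, Obj (GrpCat.of (A i))) → Obj (GrpCat.of (∀ i, A i))

namespace GroupVariety

/-- A variety is nontrivial if it is neither the variety of all groups nor the variety consisting
of the trivial groups only. -/
def IsNontrivial (V : GroupVariety.{u}) : Prop :=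
  (∃ G : GrpCat.{u}, ¬ V.Obj G) ∧ ∃ G : GrpCat.{u}, V.Obj G ∧ Nontrivial G

/-- The dominion of a subgroup `H` of `A` in the variety `V`: all `a : A` such that any two
homomorphisms from `A` to a group in `V` which agree on `H` also agree at `a`. -/
def dominion (V : GroupVariety.{u}) {A : Type u} [Group A] (H : Subgroup A) : Subgroup A where
  carrier := {a | ∀ C : GrpCat.{u}, V.Obj C → ∀ f g : A →* C, (∀ h ∈ H, f h = g h) → f a = g a}
  one_mem' := fun _ _ f g _ => by rw [map_one, map_one]
  mul_mem' := fun ha hb C hC f g h => by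
    rw [map_mul, map_mul, ha C hC f g h, hb C hC f g h]
  inv_mem' := fun ha C hC f g h => by rw [map_inv, map_inv, ha C hC f g h]

/-- The product variety `NQ`: all groups `G` with a normal subgroup `K` such that `K` belongs to
`N` and `G ⧸ K` belongs to `Q`. -/
def prod (N Q : GroupVariety.{u}) : GroupVariety.{u} where
  Obj := fun G => ∃ (K : Subgroup G) (_ : K.Normal),
    N.Obj (GrpCat.of K) ∧ Q.Obj (GrpCat.of (G ⧸ K))
  of_injective := by
    rintro A B _ _ f hf ⟨K, hK, hN, hQ⟩
    change Subgroup B at K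
    refine ⟨K.comap f, hK.comap f, N.of_injective (f.subgroupComap K) ?_ hN,
      Q.of_injective (QuotientGroup.map (K.comap f) K f le_rfl) ?_ hQ⟩
    · intro x y hxy
      exact Subtype.ext (hf (congrArg Subtype.val hxy))
    · rw [← MonoidHom.ker_eq_bot_iff, QuotientGroup.ker_map, eq_bot_iff]
      exact (QuotientGroup.map_mk'_self _).le
  of_surjective := by
    rintro A B _ _ f hf ⟨K, hK, hN, hQ⟩
    change Subgroup A at K
    have hn : (K.map f).Normal := hK.map f hf
    refine ⟨K.map f, hn, N.of_surjective (f.subgroupMap K) (f.subgroupMap_surjective K) hN,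
      Q.of_surjective (QuotientGroup.map K (K.map f) f (Subgroup.le_comap_map f K)) ?_ hQ⟩
    exact QuotientGroup.map_surjective_of_surjective _ _ _
      ((QuotientGroup.mk'_surjective (K.map f)).comp hf) _
  pi := by
    intro ι A _ h
    choose K hK hN hQ using h
    let L : Subgroup (∀ i, A i) := Subgroup.pi Set.univ K
    have hL : L.Normal := ⟨fun a ha g i hi => (hK i).conj_mem _ (ha i hi) (g i)⟩
    refine ⟨L, hL, ?_, ?_⟩
    · let φ : L →* (∀ i, K i) :=
        { toFun := fun x i => ⟨x.1 i, x.2 i (Set.mem_univ i)⟩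
          map_one' := rfl
          map_mul' := fun _ _ => rfl }
      refine N.of_injective φ ?_ (N.pi (fun i => K i) hN)
      intro x y hxy
      exact Subtype.ext (funext fun i => congrArg Subtype.val (congrFun hxy i))
    · let ψ : (∀ i, A i) →* (∀ i, A i ⧸ K i) :=
        { toFun := fun x i => QuotientGroup.mk (x i)
          map_one' := rfl
          map_mul' := fun _ _ => rfl }
      have hker : ψ.ker = L := by
        ext x
        rw [MonoidHom.mem_ker, Subgroup.mem_pi]
        constructor
        · intro hx i _
          exact (QuotientGroup.eq_one_iff (x i)).1 (congrFun hx i)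
        · intro hx
          exact funext fun i => (QuotientGroup.eq_one_iff (x i)).2 (hx i (Set.mem_univ i))
      refine Q.of_injective (QuotientGroup.lift L ψ hker.ge) ?_ (Q.pi (fun i => A i ⧸ K i) hQ)
      rw [← MonoidHom.ker_eq_bot_iff, QuotientGroup.ker_lift, hker]
      exact QuotientGroup.map_mk'_self _

end GroupVariety

/-- For a subgroup `H` of `S`, the embedding of the regular wreath product `H ≀ G` in `S ≀ G`, given
by viewing `H`-valued functions on `G` as `S`-valued functions. -/
def wreathInclusion {S : Type u} [Group S] (H : Subgroup S) (G : Type u) [Group G] :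
    (H ≀ᵣ G) →* (S ≀ᵣ G) where
  toFun x := ⟨fun g => (x.left g : S), x.right⟩
  map_one' := rfl
  map_mul' _ _ := rfl

/-! Choose a finite `G` in `Q` with `S ≀ᵣ G` outside `Q`. Every nontrivial normal subgroup of `S ≀ᵣ
G` contains the base group (`baseHom_mem_of_normal`), so a map to `C` with `M ∈ N` and `C ⧸ M ∈ Q`
must send the base into `M`. On each coordinate copy of `S` the map is then determined by its values
on `H`, by the dominion hypothesis, and the top group `G` already lies in `H ≀ᵣ G`. Such a `G`
exists because otherwise wreathing with `S` never leaves the finite groups of `Q`. Following words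
along Cayley graphs (`wreathLift_ne_one`) would then make free groups residually `Q`, and `Q` would
contain all groups (`obj_of_wreath_closed`). -/

open RegularWreathProduct

/-! ### Words as paths in a Cayley graph with one marked edge -/

namespace FreeGroup

variable {X S G : Type*} [Group S] [Group G]

open Classical in
/-- The lift of a homomorphism `ψ : FreeGroup X →* G` to the wreath product `S ≀ᵣ G` which marks
the generator `x` by the element `a` in the coordinate `1`. -/
noncomputable def wreathLift (ψ : FreeGroup X →* G) (x : X) (a : S) : FreeGroup X →* S ≀ᵣ G :=
  lift fun y => ⟨if y = x then Pi.mulSingle 1 a else 1, ψ (of y)⟩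

lemma wreathLift_right (ψ : FreeGroup X →* G) (x : X) (a : S) (w : FreeGroup X) :
    (wreathLift ψ x a w).right = ψ w := by
  have : rightHom.comp (wreathLift ψ x a) = ψ := by
    ext y
    simp [wreathLift]
  exact DFunLike.congr_fun this w

/-- The base point of the edge of the Cayley graph of `G` which a path starting at `1` follows when
it reads the letter `x` or `x⁻¹`. -/
def edgeBase (ψ : FreeGroup X →* G) (x : X) (b : Bool) : G :=
  if b then 1 else (ψ (of x))⁻¹

lemma mk_cons (p : X × Bool) (L : List (X × Bool)) : mk (p :: L) = mk [p] * mk L := by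
  rw [mul_mk, List.singleton_append]

lemma mk_singleton_true (x : X) : mk [(x, true)] = of x := rfl

lemma mk_singleton_false (x : X) : mk [(x, false)] = (of x)⁻¹ := rfl

open Classical in
lemma wreathLift_letter_left_of_ne (ψ : FreeGroup X →* G) (x : X) (a : S) (y : X) (b : Bool) (g : G)
    (h : y = x → edgeBase ψ x b ≠ g) : (wreathLift ψ x a (mk [(y, b)])).left g = 1 := by
  by_cases hy : y = x
  · subst hy
    have hg := h rfl
    cases b
    · have : ψ (of y) * g ≠ 1 := fun e => hg (by simp [edgeBase, eq_inv_of_mul_eq_one_right e])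
      simp [mk_singleton_false, wreathLift, Pi.mulSingle_eq_of_ne this]
    · have : g ≠ 1 := fun e => hg (by simp [edgeBase, e])
      simp [mk_singleton_true, wreathLift, Pi.mulSingle_eq_of_ne this]
  · cases b
    · simp [mk_singleton_false, wreathLift, hy]
    · simp [mk_singleton_true, wreathLift, hy]

lemma wreathLift_letter_left_ne_one (ψ : FreeGroup X →* G) (x : X) {a : S} (ha : a ≠ 1) (b : Bool) :
    (wreathLift ψ x a (mk [(x, b)])).left (edgeBase ψ x b) ≠ 1 := by
  cases b
  · simpa [mk_singleton_false, wreathLift, edgeBase] using ha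
  · simpa [mk_singleton_true, wreathLift, edgeBase] using ha

lemma wreathLift_cons_left (ψ : FreeGroup X →* G) (x : X) (a : S) (p : X × Bool)
    (L : List (X × Bool)) (g : G) :
    (wreathLift ψ x a (mk (p :: L))).left g =
      (wreathLift ψ x a (mk [p])).left g *
        (wreathLift ψ x a (mk L)).left ((ψ (mk [p]))⁻¹ * g) := by
  rw [mk_cons, _root_.map_mul, mul_left, Pi.mul_apply, wreathLift_right]

/-- A path which does not use the marked edge at `g` has trivial `g`-coordinate. -/
lemma wreathLift_left_eq_one (ψ : FreeGroup X →* G) (x : X) (a : S) (L : List (X × Bool)) (g : G)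
    (h : ∀ A b B, L = A ++ (x, b) :: B → ψ (mk A) * edgeBase ψ x b ≠ g) :
    (wreathLift ψ x a (mk L)).left g = 1 := by
  induction L generalizing g with
  | nil => simp [← one_eq_mk]
  | cons p L ih =>
    rw [wreathLift_cons_left, wreathLift_letter_left_of_ne, one_mul]
    · refine ih _ fun A b B hL e => h (p :: A) b B (by rw [hL, List.cons_append]) ?_
      rw [mk_cons, _root_.map_mul, mul_assoc, e, mul_inv_cancel_left]
    · rintro hy e
      refine h [] p.2 L (by rw [← hy]; rfl) ?_
      rw [← one_eq_mk, _root_.map_one, one_mul, e]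

/-- If `ψ` kills no proper nonempty subword of the reduced word `L`, then `L` is not killed by the
lift of `ψ` which marks its first letter. -/
lemma wreathLift_ne_one (ψ : FreeGroup X →* G) (x : X) (b : Bool) {a : S} (ha : a ≠ 1)
    (L : List (X × Bool)) (hred : IsReduced ((x, b) :: L))
    (hψ : ∀ A, A <:+: (x, b) :: L → A.length < ((x, b) :: L).length → A ≠ [] → ψ (mk A) ≠ 1) :
    wreathLift ψ x a (mk ((x, b) :: L)) ≠ 1 := by
  intro h
  refine wreathLift_letter_left_ne_one ψ x ha b ?_
  have h1 := congrFun (congrArg RegularWreathProduct.left h) (edgeBase ψ x b)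
  rw [wreathLift_cons_left, wreathLift_left_eq_one (L := L), mul_one] at h1
  · exact h1
  · rintro A c B rfl e
    have hprefix : ψ (mk [(x, b)]) * ψ (mk A) ≠ 1 := by
      rw [← _root_.map_mul, ← mk_cons]
      exact hψ _ ⟨[], (x, c) :: B, rfl⟩ (by simp) (by simp)
    have hinner : b = c ∨ ψ (mk A) ≠ 1 := by
      cases A with
      | nil =>
        left
        rw [List.nil_append, isReduced_cons_cons] at hred
        exact hred.1 rfl
      | cons q A =>
        right
        exact hψ _ ⟨[(x, b)], (x, c) :: B, rfl⟩ (by simp) (by simp)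
    -- If the path returns to the marked edge in the same direction, the prefix before that letter
    -- is killed by `ψ`; in the opposite direction, the inner word `A` is. Reducedness excludes
    -- empty `A` in the latter case.
    cases b <;> cases c <;>
      simp only [mk_singleton_true, mk_singleton_false, edgeBase, _root_.map_inv, inv_inv, if_true,
        mul_one, false_or, if_false, Bool.false_eq_true, mul_inv_cancel, mul_eq_right,
        Bool.true_eq_false] at e hprefix hinner
    · exact hprefix (by rw [mul_inv_eq_one.1 e, inv_mul_cancel])
    · exact hinner e
    · exact hinner e
    · exact hprefix (by rw [e, mul_inv_cancel])

end FreeGroup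

/-! ### Varieties closed under wreathing with a finite group -/

namespace GroupVariety

/-- If the variety `V` contains the wreath products of the nontrivial finite group `S` by all finite
groups of `V`, then every reduced word is nontrivial in some finite group of `V`. -/
lemma exists_hom_ne_one (V : GroupVariety.{u}) (S : Type u) [Group S] [Finite S] [Nontrivial S]
    (hV : ∀ (G : Type u) [Group G] [Finite G], V.Obj (GrpCat.of G) → V.Obj (GrpCat.of (S ≀ᵣ G)))
    {X : Type u} (L : List (X × Bool)) (hred : FreeGroup.IsReduced L) (hne : L ≠ []) :
    ∃ (G : Type u) (_ : Group G) (ψ : FreeGroup X →* G),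
      Finite G ∧ V.Obj (GrpCat.of G) ∧ ψ (FreeGroup.mk L) ≠ 1 := by
  induction hn : L.length using Nat.strong_induction_on generalizing L with
  | _ n ih =>
    subst hn
    -- There are finitely many proper subwords, so the product of their witnesses is a finite group
    -- of `V` in which none of them dies.
    let T := {A : List (X × Bool) // A <:+: L ∧ A.length < L.length ∧ A ≠ []}
    have : Finite T := by
      refine Set.Finite.subset (List.finite_toSet L.sublists) fun A hA => ?_
      exact List.mem_sublists.2 hA.1.sublist
    have hT (A : T) := ih A.1.length A.2.2.1 A.1 (hred.infix A.2.1) A.2.2.2 rfl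
    choose G hG ψ hfin hGV hψ using hT
    obtain ⟨a, ha⟩ := exists_ne (1 : S)
    cases L with
    | nil => exact absurd rfl hne
    | cons p L =>
      refine ⟨S ≀ᵣ (∀ A, G A), inferInstance, FreeGroup.wreathLift (MonoidHom.pi ψ) p.1 a,
        inferInstance, hV _ (V.pi G hGV), ?_⟩
      refine FreeGroup.wreathLift_ne_one _ _ p.2 ha _ hred fun A h1 h2 h3 h => ?_
      exact hψ ⟨A, h1, h2, h3⟩ (congrFun h ⟨A, h1, h2, h3⟩)

/-- The free group on the set `C` embeds in a product of groups of `V`, one for each nontrivial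
element, and `C` is its quotient. -/
lemma obj_of_wreath_closed (V : GroupVariety.{u}) (S : Type u) [Group S] [Finite S] [Nontrivial S]
    (hV : ∀ (G : Type u) [Group G] [Finite G], V.Obj (GrpCat.of G) → V.Obj (GrpCat.of (S ≀ᵣ G)))
    (C : Type u) [Group C] : V.Obj (GrpCat.of C) := by
  classical
  have hF (w : {w : FreeGroup C // w ≠ 1}) :=
    V.exists_hom_ne_one S hV w.1.toWord FreeGroup.isReduced_toWord
      (mt FreeGroup.toWord_eq_nil_iff.1 w.2)
  choose G hG ψ _ hGV hψ using hF
  refine V.of_surjective (FreeGroup.lift (id : C → C))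
    (fun c => ⟨FreeGroup.of c, FreeGroup.lift_apply_of⟩)
    (V.of_injective (MonoidHom.pi ψ) ?_ (V.pi G hGV))
  refine (injective_iff_map_eq_one _).2 fun w hw => ?_
  by_contra hne
  apply hψ ⟨w, hne⟩
  rw [FreeGroup.mk_toWord]
  exact congrFun hw ⟨w, hne⟩

end GroupVariety

/-! ### Normal subgroups of the wreath product -/

namespace RegularWreathProduct

variable {S G : Type*} [Group S] [Group G]

/-- The embedding of the base group in the wreath product. -/
def baseHom (S G : Type*) [Group S] [Group G] : (G → S) →* S ≀ᵣ G where
  toFun t := ⟨t, 1⟩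
  map_one' := rfl
  map_mul' _ _ := by ext <;> simp

@[simp] lemma baseHom_left (t : G → S) : (baseHom S G t).left = t := rfl

@[simp] lemma baseHom_right (t : G → S) : (baseHom S G t).right = 1 := rfl

lemma baseHom_mul_inl (x : S ≀ᵣ G) : baseHom S G x.left * inl x.right = x := by
  ext <;> simp

/-- A nontrivial normal subgroup of the wreath product of a nonabelian simple group by a finite group
contains the base group. -/
lemma baseHom_mem_of_normal [IsSimpleGroup S] [Finite G] (hS : ∃ a b : S, a * b ≠ b * a)
    (K : Subgroup (S ≀ᵣ G)) [hK : K.Normal] (hne : K ≠ ⊥) (t : G → S) : baseHom S G t ∈ K := by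
  classical
  have hcomm {x : S ≀ᵣ G} (hx : x ∈ K) (y : S ≀ᵣ G) : x * (y * x⁻¹ * y⁻¹) ∈ K :=
    K.mul_mem hx (hK.conj_mem _ (K.inv_mem hx) y)
  have hcenter : Subgroup.center S = ⊥ := by
    refine (Subgroup.Normal.eq_bot_or_eq_top inferInstance).resolve_right fun h => ?_
    obtain ⟨a, b, hab⟩ := hS
    exact hab ((Subgroup.mem_center_iff.1 (h ▸ Subgroup.mem_top a : a ∈ Subgroup.center S) b).symm)
  obtain ⟨t₀, ht₀, g₀, hg₀⟩ : ∃ t₀, baseHom S G t₀ ∈ K ∧ ∃ g₀, t₀ g₀ ≠ 1 := by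
    obtain ⟨x, hx, hx1⟩ := K.ne_bot_iff_exists_ne_one.1 hne |>.elim fun x hx =>
      (⟨x.1, x.2, fun h => hx (Subtype.ext h)⟩ : ∃ x ∈ K, x ≠ 1)
    by_cases hq : x.right = 1
    · refine ⟨x.left, ?_, ?_⟩
      · convert hx using 1
        ext <;> simp [hq]
      · by_contra! h
        exact hx1 (RegularWreathProduct.ext (funext h) hq)
    -- Conjugation by `x` moves the support of `y` off the coordinate `1`, so the commutator lies in
    -- the base and equals `a⁻¹` there.
    · obtain ⟨a, ha⟩ := exists_ne (1 : S)
      let y := baseHom S G (Pi.mulSingle 1 a)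
      refine ⟨(x * (y * x⁻¹ * y⁻¹)).left, ?_, 1, ?_⟩
      · convert hcomm hx y using 1
        refine RegularWreathProduct.ext rfl ?_
        simp [y]
      · have : x.right⁻¹ ≠ 1 := by simpa using hq
        simp [y, Pi.mulSingle_eq_of_ne this, ha]
  obtain ⟨b, hb⟩ : ∃ b, t₀ g₀ * b ≠ b * t₀ g₀ := by
    by_contra! h
    exact hg₀ (by simpa [hcenter] using Subgroup.mem_center_iff.2 fun b => (h b).symm)
  -- The trace of `K` on the copy of `S` at `g₀` is all of `S` by simplicity: it contains the
  -- nontrivial commutator of `t₀ g₀` and `b`.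
  let J : Subgroup S := K.comap ((baseHom S G).comp (MonoidHom.mulSingle (fun _ => S) g₀))
  have hJ : ∀ s, s ∈ J ↔ baseHom S G (Pi.mulSingle g₀ s) ∈ K := fun s => Iff.rfl
  have hJn : J.Normal := hK.comap _
  have hJtop : J = ⊤ := by
    refine hJn.eq_bot_or_eq_top.resolve_left fun h => ?_
    have hmem : t₀ g₀ * (b * (t₀ g₀)⁻¹ * b⁻¹) ∈ J := by
      rw [hJ]
      convert hcomm ht₀ (baseHom S G (Pi.mulSingle g₀ b)) using 1
      simp only [← map_inv, ← map_mul]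
      congr 1
      ext g
      by_cases hg : g = g₀
      · subst hg
        simp
      · simp [Pi.mulSingle_eq_of_ne hg]
    rw [h, Subgroup.mem_bot] at hmem
    apply hb
    rwa [← mul_assoc, mul_inv_eq_one, ← mul_assoc, mul_inv_eq_iff_eq_mul] at hmem
  have hsingle (g : G) (s : S) : baseHom S G (Pi.mulSingle g s) ∈ K := by
    have h1 : baseHom S G (Pi.mulSingle g₀ s) ∈ K := (hJ s).1 (hJtop ▸ Subgroup.mem_top s)
    -- Conjugation by the top group carries the coordinate `g₀` to `g`.
    convert hK.conj_mem _ h1 (inl (g * g₀⁻¹)) using 1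
    ext k
    · by_cases hk : k = g
      · subst hk
        simp
      · have : g₀ * g⁻¹ * k ≠ g₀ := by
          simpa [mul_assoc, inv_mul_eq_one] using fun e : g = k => hk e.symm
        simp [Pi.mulSingle_eq_of_ne hk, Pi.mulSingle_eq_of_ne this]
    · simp
  exact Subgroup.pi_mem_of_mulSingle_mem (H := K.comap (baseHom S G)) t fun g => hsingle g (t g)

end RegularWreathProduct

/-! ### The epimorphism property in the product variety -/

namespace GroupVariety

lemma wreath_mem_prod (N Q : GroupVariety.{u}) (A G : Type u) [Group A] [Group G]
    (hA : N.Obj (GrpCat.of A)) (hG : Q.Obj (GrpCat.of G)) :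
    (N.prod Q).Obj (GrpCat.of (A ≀ᵣ G)) := by
  let π : A ≀ᵣ G →* G := rightHom
  refine ⟨π.ker, inferInstance, ?_, Q.of_injective _ (QuotientGroup.kerLift_injective π) hG⟩
  let φ : π.ker →* (G → A) :=
    { toFun := fun x => x.1.left
      map_one' := rfl
      map_mul' := fun x y => by
        have hx : x.1.right = 1 := x.2
        simp [hx] }
  refine N.of_injective φ (fun x y hxy => Subtype.ext (RegularWreathProduct.ext hxy ?_))
    (N.pi (fun _ => A) fun _ => hA)
  exact (show x.1.right = 1 from x.2).trans (show y.1.right = 1 from y.2).symm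

/-- A homomorphism from `S ≀ᵣ G` to a group of `Q` kills the base group, if `S ≀ᵣ G` is not
in `Q`. -/
lemma map_baseHom_eq_one (Q : GroupVariety.{u}) {S G D : Type u} [Group S] [Group G] [Group D]
    [IsSimpleGroup S] [Finite G] (hS : ∃ a b : S, a * b ≠ b * a)
    (hSG : ¬ Q.Obj (GrpCat.of (S ≀ᵣ G))) (hD : Q.Obj (GrpCat.of D)) (f : S ≀ᵣ G →* D)
    (t : G → S) : f (baseHom S G t) = 1 :=
  baseHom_mem_of_normal hS f.ker
    (fun h => hSG (Q.of_injective f ((MonoidHom.ker_eq_bot_iff f).1 h) hD)) t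

/-- Homomorphisms from `S ≀ᵣ G` to a group of `NQ` which agree on `H ≀ᵣ G` are equal. -/
lemma hom_eq_of_comp_wreathInclusion_eq (N Q : GroupVariety.{u}) {S G C : Type u} [Group S]
    [Group G] [Group C] [IsSimpleGroup S] [Finite G] (hS : ∃ a b : S, a * b ≠ b * a)
    (hSG : ¬ Q.Obj (GrpCat.of (S ≀ᵣ G))) {H : Subgroup S} (hdom : N.dominion H = ⊤)
    (hC : (N.prod Q).Obj (GrpCat.of C)) {f g : S ≀ᵣ G →* C}
    (h : f.comp (wreathInclusion H G) = g.comp (wreathInclusion H G)) : f = g := by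
  classical
  obtain ⟨M, hM, hMN, hMQ⟩ := hC
  change Subgroup C at M
  have hmem (k : S ≀ᵣ G →* C) (t : G → S) : k (baseHom S G t) ∈ M := by
    rw [← QuotientGroup.eq_one_iff]
    exact Q.map_baseHom_eq_one hS hSG hMQ ((QuotientGroup.mk' M).comp k) t
  have happ (x : H ≀ᵣ G) : f (wreathInclusion H G x) = g (wreathInclusion H G x) :=
    DFunLike.congr_fun h x
  have hsingle (i : G) (s : S) :
      f (baseHom S G (Pi.mulSingle i s)) = g (baseHom S G (Pi.mulSingle i s)) := by
    -- Restricted to one coordinate, `k` takes values in a group of `N`, where the dominion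
    -- hypothesis applies.
    let coord (k : S ≀ᵣ G →* C) : S →* M :=
      (k.comp ((baseHom S G).comp (MonoidHom.mulSingle (fun _ => S) i))).codRestrict M
        fun _ => hmem k _
    have hs : s ∈ N.dominion H := hdom ▸ Subgroup.mem_top s
    refine congrArg Subtype.val (hs (GrpCat.of M) hMN (coord f) (coord g) fun x hx => ?_)
    have hincl : baseHom S G (Pi.mulSingle i x) =
        wreathInclusion H G ⟨Pi.mulSingle i ⟨x, hx⟩, 1⟩ :=
      RegularWreathProduct.ext
        (funext fun j => (Pi.apply_mulSingle (fun _ => H.subtype) (fun _ => rfl) i ⟨x, hx⟩ j).symm)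
        rfl
    refine Subtype.ext ?_
    change f (baseHom S G (Pi.mulSingle i x)) = g (baseHom S G (Pi.mulSingle i x))
    rw [hincl, happ]
  have hbase (t : G → S) : f (baseHom S G t) = g (baseHom S G t) :=
    Subgroup.pi_mem_of_mulSingle_mem
      (H := (f.comp (baseHom S G)).eqLocus (g.comp (baseHom S G))) t fun i => hsingle i (t i)
  ext x
  rw [← baseHom_mul_inl x, map_mul, map_mul, hbase]
  exact congrArg _ (happ ⟨1, x.right⟩)

end GroupVariety

theorem theorem5p5 (N Q : GroupVariety.{u}) (hN : N.IsNontrivial) (hQ : Q.IsNontrivial)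
    (S : Type u) [Group S] [Finite S] [IsSimpleGroup S]
    (hnonab : ∃ a b : S, a * b ≠ b * a)
    (hSN : N.Obj (GrpCat.of S))
    (H : Subgroup S) (hH : H ≠ ⊤) (hdom : N.dominion H = ⊤) :
    ∃ (G : Type u) (_ : Group G), Finite G ∧ Q.Obj (GrpCat.of G) ∧
      Finite (H ≀ᵣ G) ∧ Finite (S ≀ᵣ G) ∧
      Function.Injective (wreathInclusion H G) ∧
      ¬ Function.Surjective (wreathInclusion H G) ∧
      ∃ (hHG : (N.prod Q).Obj (GrpCat.of (H ≀ᵣ G)))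
        (hSG : (N.prod Q).Obj (GrpCat.of (S ≀ᵣ G))),
        Epi (ObjectProperty.homMk (GrpCat.ofHom (wreathInclusion H G)) :
          (⟨GrpCat.of (H ≀ᵣ G), hHG⟩ : (N.prod Q).Obj.FullSubcategory) ⟶
            ⟨GrpCat.of (S ≀ᵣ G), hSG⟩) := by
  obtain ⟨G, hG, hfin, hGQ, hSG⟩ : ∃ (G : Type u) (_ : Group G), Finite G ∧ Q.Obj (GrpCat.of G) ∧
      ¬ Q.Obj (GrpCat.of (S ≀ᵣ G)) := by
    by_contra! h
    obtain ⟨⟨C, hC⟩, -⟩ := hQ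
    exact hC (Q.obj_of_wreath_closed S (fun G _ _ hG => h G inferInstance inferInstance hG) C)
  refine ⟨G, hG, hfin, hGQ, inferInstance, inferInstance, fun x y hxy => ?_, fun hsurj => ?_,
    N.wreath_mem_prod Q H G (N.of_injective H.subtype H.subtype_injective hSN) hGQ,
    N.wreath_mem_prod Q S G hSN hGQ, ⟨fun {Z} f g hfg => ?_⟩⟩
  · refine RegularWreathProduct.ext (funext fun i => Subtype.ext ?_)
      (show (wreathInclusion H G x).right = (wreathInclusion H G y).right by rw [hxy])
    exact congrFun (congrArg RegularWreathProduct.left hxy) i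
  · refine hH ((Subgroup.eq_top_iff' H).2 fun s => ?_)
    obtain ⟨x, hx⟩ := hsurj ⟨fun _ => s, 1⟩
    have hxs : (x.left 1 : S) = s := congrFun (congrArg RegularWreathProduct.left hx) 1
    exact hxs ▸ (x.left 1).2
  · refine ObjectProperty.hom_ext _ (GrpCat.hom_ext ?_)
    refine N.hom_eq_of_comp_wreathInclusion_eq Q hnonab hSG hdom Z.property ?_
    exact congrArg (fun k => k.hom.hom) hfg
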